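/- Consider a two-settlement electricity market with a set of buses $\mathcal N$, finitely many participants $\mathcal P$ (participant $i$ located at bus $n(i)$) and finitely many directed lines $\mathcal L$, and a probability space $(\Omega,\mathcal A,\mathbb P)$ of scenarios. A day-ahead decision is $y_1=((x_i)_{i\in\mathcal P},(f_l)_{l\in\mathcal L})\in\mathbb R^{n_1}$ and a real-time decision is $y_2=((X_i)_{i\in\mathcal P},(F_l)_{l\in\mathcal L})$, where $n_1=|\mathcal P|+|\mathcal L|$. Given real capacity bounds $x^{\min},x^{\max},X^{\min},X^{\max}\in\mathbb R^{\mathcal P}$ and $f^{\min},f^{\max},F^{\min},F^{\max}\in\mathbb R^{\mathcal L}$, a set $\mathcal F\subseteq\mathbb R^{\mathcal L}$ of admissible flows and measurable functions $X^{\rm avail}_i:\Omega\to\mathbb R$, put $$C_1=\{y_1:\ x_i^{\min}\le x_i\le x_i^{\max},\ f_l^{\min}\le f_l\le f_l^{\max},\ f\in\mathcal F\},$$ $$C_2(\omega)=\{y_2:\ \max\{X_i^{\min},-X_i^{\rm avail}(\omega)\}\le X_i\le \min\{X_i^{\max},X_i^{\rm avail}(\omega)\},\ F_l^{\min}\le F_l\le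 F_l^{\max},\ F\in\mathcal F\}.$$ Let $\tau_n(f)$ be the inflow minus the outflow at bus $n$, and for each $n\in\mathcal N$ let $g_1(y_1)_n=\tau_n(f)+\sum_{n(i)=n}x_i$ and $g_2(y_1,y_2,\omega)_n=\tau_n(F)-\tau_n(f)+\sum_{n(i)=n}(X_i-x_i)$. For given $c_i,\delta_i^+,\delta_i^-\in\mathbb R$ the costs are $f_1(y_1)=\sum_i c_ix_i$ and $$f_2(y_1,y_2,\omega)=\sum_i\big[(c_i+\delta_i^+)(X_i-x_i)_+-(c_i-\delta_i^-)(X_i-x_i)_-\big],$$ where $(a)_+=\max\{a,0\}$ and $(a)_-=\max\{-a,0\}$. Let $H(y_1,\omega)=\inf\{f_2(y_1,y_2,\omega): y_2\in C_2(\omega),\ g_2(y_1,y_2,\omega)=0\}$; let $\phi(y_1,\omega)=f_1(y_1)+H(y_1,\omega)$ if $y_1\in C_1$ and $g_1(y_1)=0$, and $\phi(y_1,\omega)=+\infty$ otherwise; and let $\phi^*(s,\omega)=\sup_{y\in\mathbb R^{n_1}}\{\langle s,y\rangle-\phi(y,\omega)\}$. Assume that $C_1$ and all $C_2(\omega)$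 are convex, closed and nonempty, that $f_1$ and every $f_2(\cdot,\cdot,\omega)$ are convex, and that $f_2(y_1,y_2,\cdot)$ is measurable for all $y_1,y_2$. Suppose that the state-vector problem $$\min\ \big\{\mathbb E[\phi(y_1(\omega),\omega)]\ :\ y_1\in L^\infty(\Omega;\mathbb R^{n_1}),\ \chi_1\in\mathbb R^{n_1},\ y_1(\omega)-\chi_1=0\ \text{a.s.}\big\}$$ has an optimal solution $(\bar y_1,\bar\chi_1)$ and that its optimal value satisfies $\nu_p^\star<\infty$. Then the dual problem $$\sup\ \big\{-\mathbb E[\phi^*(\sigma(\omega),\omega)]\ :\ \sigma\in L^1(\Omega;\mathbb R^{n_1}),\ \mathbb E[\sigma]=0\big\}$$ is feasible (there is a feasible $\sigma$ with $-\mathbb E[\phi^*(\sigma(\omega),\omega)]>-\infty$), and its optimal value equals $\nu_p^\star$. -/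

import Mathlib

open MeasureTheory
open scoped ENNReal

noncomputable section

/-- The data of a two-settlement electricity market.  `Node` is the set of buses, `Part` the set of
market participants, `Line` the set of (directed) lines and `Ω` the set of scenarios. -/
structure Market (Node Part Line Ω : Type*) where
  /-- the bus at which a participant is located -/
  loc : Part → Node
  /-- the tail `i` of a line `(i, j)` -/
  src : Line → Node
  /-- the head `j` of a line `(i, j)` -/
  dst : Line → Node
  /-- day-ahead price bids -/
  c : Part → ℝ
  /-- premium for positive real-time deviations -/
  δpos : Part → ℝ
  /-- premium for negative real-time deviations -/
  δneg : Part → ℝ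
  /-- day-ahead lower capacities -/
  xmin : Part → ℝ
  /-- day-ahead upper capacities -/
  xmax : Part → ℝ
  /-- day-ahead lower line limits -/
  fmin : Line → ℝ
  /-- day-ahead upper line limits -/
  fmax : Line → ℝ
  /-- real-time lower capacities -/
  Xmin : Part → ℝ
  /-- real-time upper capacities -/
  Xmax : Part → ℝ
  /-- real-time lower line limits -/
  Fmin : Line → ℝ
  /-- real-time upper line limits -/
  Fmax : Line → ℝ
  /-- available real-time quantity of each participant in each scenario -/
  Xavail : Ω → Part → ℝ
  /-- the set of physically admissible power flows -/
  flows : Set (Line → ℝ)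

/-- The space `ℝ^{n₁}` of day-ahead decisions `y₁ = (x, f)`; it is also the space of the real-time
decisions `y₂ = (X, F)`.  Coordinates: `Sum.inl i` for the quantity of participant `i`,
`Sum.inr l` for the flow on line `l`. -/
abbrev Dec (Part Line : Type*) : Type _ := EuclideanSpace ℝ (Part ⊕ Line)

/-- Expectation of an extended-real-valued function, `E[g⁺] - E[g⁻]`, with the usual convention of
minimization problems that it is `+∞` as soon as `E[g⁺] = +∞`. -/
def eexp {Ω : Type*} [MeasurableSpace Ω] (μ : Measure Ω) (g : Ω → EReal) : EReal :=
  if ∫⁻ ω, (g ω).toENNReal ∂μ = ⊤ then ⊤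
  else ((∫⁻ ω, (g ω).toENNReal ∂μ : ℝ≥0∞) : EReal)
    - ((∫⁻ ω, (-(g ω)).toENNReal ∂μ : ℝ≥0∞) : EReal)

namespace Market

variable {Node Part Line Ω : Type*} [Fintype Part] [Fintype Line] (m : Market Node Part Line Ω)

open Classical in
/-- Net flow (inflow minus outflow) `τ_n` at the bus `n`. -/
def netFlow (y : Dec Part Line) (n : Node) : ℝ :=
  (∑ l : Line with m.dst l = n, y (Sum.inr l)) - ∑ l : Line with m.src l = n, y (Sum.inr l)

open Classical in
/-- Total quantity cleared at the bus `n`. -/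
def injection (y : Dec Part Line) (n : Node) : ℝ := ∑ i : Part with m.loc i = n, y (Sum.inl i)

/-- Capacity set `C₁` of the day-ahead decisions. -/
def C1 : Set (Dec Part Line) :=
  {y | (∀ i, m.xmin i ≤ y (Sum.inl i) ∧ y (Sum.inl i) ≤ m.xmax i) ∧
    (∀ l, m.fmin l ≤ y (Sum.inr l) ∧ y (Sum.inr l) ≤ m.fmax l) ∧
    (fun l => y (Sum.inr l)) ∈ m.flows}

/-- Capacity set `C₂(ω)` of the real-time decisions. -/
def C2 (ω : Ω) : Set (Dec Part Line) :=
  {y | (∀ i, max (m.Xmin i) (-m.Xavail ω i) ≤ y (Sum.inl i) ∧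
      y (Sum.inl i) ≤ min (m.Xmax i) (m.Xavail ω i)) ∧
    (∀ l, m.Fmin l ≤ y (Sum.inr l) ∧ y (Sum.inr l) ≤ m.Fmax l) ∧
    (fun l => y (Sum.inr l)) ∈ m.flows}

/-- Day-ahead flow balance `g₁(y₁)`, one component for each bus. -/
def g1 (y₁ : Dec Part Line) : Node → ℝ := fun n => m.netFlow y₁ n + m.injection y₁ n

/-- Real-time flow balance `g₂(y₁, y₂, ω)`, one component for each bus. -/
def g2 (y₁ y₂ : Dec Part Line) (_ω : Ω) : Node → ℝ := fun n =>
  m.netFlow y₂ n - m.netFlow y₁ n + (m.injection y₂ n - m.injection y₁ n)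

/-- Day-ahead cost `f₁`. -/
def f1 (y₁ : Dec Part Line) : ℝ := ∑ i, m.c i * y₁ (Sum.inl i)

/-- Real-time adjustment cost `f₂`; `(a)₊ = max a 0` and `(a)₋ = max (-a) 0`. -/
def f2 (y₁ y₂ : Dec Part Line) (_ω : Ω) : ℝ :=
  ∑ i, ((m.c i + m.δpos i) * max (y₂ (Sum.inl i) - y₁ (Sum.inl i)) 0
    - (m.c i - m.δneg i) * max (-(y₂ (Sum.inl i) - y₁ (Sum.inl i))) 0)

/-- The convexity assumption: `C₁` and every `C₂(ω)` are convex, closed and nonempty; `f₁` and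
`f₂(·, ·, ω)` are (finite) convex functions, and `f₂` is measurable in the scenario. -/
structure ConvexityAssumption [MeasurableSpace Ω] : Prop where
  convex_C1 : Convex ℝ m.C1
  closed_C1 : IsClosed m.C1
  nonempty_C1 : m.C1.Nonempty
  convex_C2 : ∀ ω, Convex ℝ (m.C2 ω)
  closed_C2 : ∀ ω, IsClosed (m.C2 ω)
  nonempty_C2 : ∀ ω, (m.C2 ω).Nonempty
  convex_f1 : ConvexOn ℝ Set.univ m.f1
  convex_f2 : ∀ ω, ConvexOn ℝ Set.univ fun p : Dec Part Line × Dec Part Line => m.f2 p.1 p.2 ω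
  measurable_f2 : ∀ y₁ y₂, Measurable fun ω => m.f2 y₁ y₂ ω

/-- Optimal value `H(y₁, ω)` of the real-time problem (`+∞` if it is infeasible). -/
def H (y₁ : Dec Part Line) (ω : Ω) : EReal :=
  ⨅ y₂ ∈ {y₂ | y₂ ∈ m.C2 ω ∧ m.g2 y₁ y₂ ω = 0}, (m.f2 y₁ y₂ ω : EReal)

open Classical in
/-- The extended-real-valued scenario cost `φ(y₁, ω)`. -/
def phi (y₁ : Dec Part Line) (ω : Ω) : EReal :=
  if m.g1 y₁ = 0 ∧ y₁ ∈ m.C1 then (m.f1 y₁ : EReal) + m.H y₁ ω else ⊤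

/-- The conjugate `φ*(s, ω) = sup_y (⟨s, y⟩ - φ(y, ω))`. -/
def phiConj (s : Dec Part Line) (ω : Ω) : EReal :=
  ⨆ y : Dec Part Line, ((inner ℝ s y : ℝ) : EReal) - m.phi y ω

variable [MeasurableSpace Ω] (μ : Measure Ω)

/-- Objective `E[φ(y(ω), ω)]` of the state-vector primal, for `y ∈ L^∞`. -/
def primalObj (y : Lp (Dec Part Line) ∞ μ) : EReal := eexp μ fun ω => m.phi (y ω) ω

/-- Feasible region of the state-vector primal: `y(ω) - χ = 0` almost surely. -/
def primalFeasible (Part Line : Type*) [Fintype Part] [Fintype Line] (μ : Measure Ω) :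
    Set (Lp (Dec Part Line) ∞ μ × Dec Part Line) :=
  {p | ∀ᵐ ω ∂μ, p.1 ω - p.2 = 0}

/-- Optimal value of the state-vector primal. -/
def primalValue : EReal := ⨅ p ∈ primalFeasible Part Line μ, m.primalObj μ p.1

/-- `(y, χ)` is an optimal solution of the state-vector primal. -/
def IsPrimalOptimal (y : Lp (Dec Part Line) ∞ μ) (χ : Dec Part Line) : Prop :=
  (y, χ) ∈ primalFeasible Part Line μ ∧
    ∀ p ∈ primalFeasible Part Line μ, m.primalObj μ y ≤ m.primalObj μ p.1

/-- The multipliers: `σ ∈ L¹` with `E[σ] = 0`. -/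
def multipliers (Part Line : Type*) [Fintype Part] [Fintype Line] (μ : Measure Ω) :
    Set (Lp (Dec Part Line) 1 μ) :=
  {σ | ∫ ω, σ ω ∂μ = 0}

/-- Objective `-E[φ*(σ(ω), ω)]` of the dual. -/
def dualObj (σ : Lp (Dec Part Line) 1 μ) : EReal := -eexp μ fun ω => m.phiConj (σ ω) ω

/-- Optimal value of the dual. -/
def dualValue : EReal := ⨆ σ ∈ multipliers Part Line μ, m.dualObj μ σ

end Market

end

/-! The cost `phi` is an extended-valued convex integrand, so Hahn–Banach cannot be applied to its
expectation directly: the domain may have no interior. It is therefore approximated from below by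
finite integrands. Only the availability bounds depend on the scenario, so all other constraints
define one compact convex set `W` of pairs `(y₁, y₂)`. Minimizing over `W` the total cost plus `k +
1` times (distance of `y` from `y₁` plus violation of availability) gives `penalizedValue`, which is
convex and `(k + 1)`-Lipschitz in `y` and increases to `phi` by compactness (`iSup_penalizedValue`).

For a Lipschitz integrand the expectation is a continuous convex functional on `L²`. Separating its
strict epigraph from the constants at the minimal level yields a centred multiplier
(`exists_centred_subgradient`). Since the approximants lie below `phi`, `phiConj` lies below their
conjugates, so this multiplier gives the true dual at least the penalized minimum
(`exists_multiplier`). The penalized minima rise to the primal value, by uniform coercivity,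
compactness and monotone convergence (`exists_eexp_le`). The converse inequality is Fenchel–Young
(`weak_duality`). -/

section NormL2

variable {Ω E : Type*} [MeasurableSpace Ω] [NormedAddCommGroup E] {μ : Measure Ω}
  [IsProbabilityMeasure μ]

theorem LipschitzConvexIntegrand.integrable_coe_L2 (y : Lp E 2 μ) : Integrable y μ :=
  (Lp.memLp y).integrable (by norm_num)

theorem LipschitzConvexIntegrand.integral_norm_le_norm_L2 (y : Lp E 2 μ) : ∫ ω, ‖y ω‖ ∂μ ≤ ‖y‖ := by
  rw [integral_norm_eq_lintegral_enorm (Lp.aestronglyMeasurable y), Lp.norm_def,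
    ← eLpNorm_one_eq_lintegral_enorm]
  exact ENNReal.toReal_mono (Lp.memLp y).2.ne
    (eLpNorm_le_eLpNorm_of_exponent_le (by norm_num) (Lp.aestronglyMeasurable y))

end NormL2

/-- A convex integrand on `E`: integrable in the scenario, and convex and `K`-Lipschitz in the
decision, uniformly over all scenarios. -/
structure LipschitzConvexIntegrand {Ω E : Type*} [MeasurableSpace Ω] [NormedAddCommGroup E]
    [NormedSpace ℝ E] (μ : Measure Ω) (K : ℝ) (ψ : E → Ω → ℝ) : Prop where
  lip : ∀ ω y z, |ψ y ω - ψ z ω| ≤ K * ‖y - z‖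
  convex : ∀ ω, ConvexOn ℝ Set.univ fun y => ψ y ω
  measurable : ∀ y, Measurable (ψ y)
  integrable : ∀ y, Integrable (ψ y) μ

/-! ### Integral functionals of Lipschitz convex integrands and their `L²` multipliers. -/

namespace LipschitzConvexIntegrand

section Basic

variable {Ω E : Type*} [MeasurableSpace Ω] [NormedAddCommGroup E] [NormedSpace ℝ E]
  {μ : Measure Ω} {K : ℝ} {ψ : E → Ω → ℝ}

theorem continuous (h : LipschitzConvexIntegrand μ K ψ) (ω : Ω) : Continuous fun y => ψ y ω := by
  refine (LipschitzWith.of_dist_le_mul (K := K.toNNReal) fun y z => ?_).continuous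
  rw [Real.dist_eq, dist_eq_norm]
  exact (h.lip ω y z).trans (by gcongr; exact Real.le_coe_toNNReal K)

theorem integrable_comp [FiniteDimensional ℝ E] (h : LipschitzConvexIntegrand μ K ψ)
    {y : Ω → E} (hy : Integrable y μ) : Integrable (fun ω => ψ (y ω) ω) μ := by
  borelize E
  have : SecondCountableTopology E := by
    have := FiniteDimensional.proper_real E
    infer_instance
  have hmeas : Measurable (Function.uncurry ψ) :=
    measurable_uncurry_of_continuous_of_measurable h.continuous h.measurable
  have hbd : Integrable (fun ω => |ψ 0 ω| + K * ‖y ω‖) μ :=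
    (h.integrable 0).abs.add (hy.norm.const_mul K)
  refine hbd.mono' ?_ (Filter.Eventually.of_forall fun ω => ?_)
  · exact (hmeas.comp_aemeasurable
      (hy.aestronglyMeasurable.aemeasurable.prodMk aemeasurable_id)).aestronglyMeasurable
  · have h1 := h.lip ω (y ω) 0
    rw [sub_zero] at h1
    rw [Real.norm_eq_abs]
    linarith [abs_sub_abs_le_abs_sub (ψ (y ω) ω) (ψ 0 ω)]

theorem abs_integral_sub_le [FiniteDimensional ℝ E] (h : LipschitzConvexIntegrand μ K ψ)
    {y z : Ω → E} (hy : Integrable y μ) (hz : Integrable z μ) :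
    |∫ ω, ψ (y ω) ω ∂μ - ∫ ω, ψ (z ω) ω ∂μ| ≤ K * ∫ ω, ‖y ω - z ω‖ ∂μ := by
  rw [← integral_sub (h.integrable_comp hy) (h.integrable_comp hz), ← integral_const_mul]
  exact (abs_integral_le_integral_abs).trans (integral_mono
    ((h.integrable_comp hy).sub (h.integrable_comp hz)).abs ((hy.sub hz).norm.const_mul K)
    fun ω => h.lip ω _ _)

theorem continuous_integral [IsProbabilityMeasure μ] (h : LipschitzConvexIntegrand μ K ψ) :
    Continuous fun y => ∫ ω, ψ y ω ∂μ := by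
  refine (LipschitzWith.of_dist_le_mul (K := K.toNNReal) fun y z => ?_).continuous
  rw [Real.dist_eq, dist_eq_norm, ← integral_sub (h.integrable y) (h.integrable z)]
  refine (abs_integral_le_integral_abs).trans ((integral_mono
    ((h.integrable y).sub (h.integrable z)).abs (integrable_const (K * ‖y - z‖))
    fun ω => h.lip ω _ _).trans ?_)
  rw [integral_const, probReal_univ, one_smul]
  gcongr
  exact Real.le_coe_toNNReal K

end Basic

section Duality

variable {Ω E : Type*} [MeasurableSpace Ω] [NormedAddCommGroup E] [InnerProductSpace ℝ E]
  [FiniteDimensional ℝ E] {μ : Measure Ω} [IsProbabilityMeasure μ] {K : ℝ} {ψ : E → Ω → ℝ}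

theorem continuous_integral_L2 (h : LipschitzConvexIntegrand μ K ψ) (hK : 0 ≤ K) :
    Continuous fun y : Lp E 2 μ => ∫ ω, ψ (y ω) ω ∂μ := by
  refine (LipschitzWith.of_dist_le_mul (K := K.toNNReal) fun y z => ?_).continuous
  rw [Real.dist_eq, dist_eq_norm, Real.coe_toNNReal K hK]
  refine (h.abs_integral_sub_le (integrable_coe_L2 y) (integrable_coe_L2 z)).trans ?_
  gcongr
  refine le_trans (le_of_eq ?_) (integral_norm_le_norm_L2 (y - z))
  refine integral_congr_ae ?_
  filter_upwards [Lp.coeFn_sub y z] with ω hω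
  rw [hω, Pi.sub_apply]

theorem convexOn_integral_L2 (h : LipschitzConvexIntegrand μ K ψ) :
    ConvexOn ℝ Set.univ fun y : Lp E 2 μ => ∫ ω, ψ (y ω) ω ∂μ := by
  refine ⟨convex_univ, fun y _ z _ a b ha hb hab => ?_⟩
  have hy := h.integrable_comp (integrable_coe_L2 y)
  have hz := h.integrable_comp (integrable_coe_L2 z)
  simp only [smul_eq_mul]
  rw [← integral_const_mul, ← integral_const_mul,
    ← integral_add (hy.const_mul a) (hz.const_mul b)]
  refine integral_mono_ae (h.integrable_comp (integrable_coe_L2 _))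
    ((hy.const_mul a).add (hz.const_mul b)) ?_
  filter_upwards [Lp.coeFn_add (a • y) (b • z), Lp.coeFn_smul a y, Lp.coeFn_smul b z]
    with ω h1 h2 h3
  rw [h1, Pi.add_apply, h2, h3]
  exact (h.convex ω).2 trivial trivial ha hb hab

/-- Hahn–Banach: the strict epigraph of `J` is open and convex, and minimality of `χ` keeps it off
the set of constants at height `v`. The space `L²` is used so that Riesz turns the separating
functional into a function. -/
theorem exists_L2_multiplier (h : LipschitzConvexIntegrand μ K ψ) (hK : 0 ≤ K) {χ : E}
    (hχ : ∀ y, ∫ ω, ψ χ ω ∂μ ≤ ∫ ω, ψ y ω ∂μ) :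
    ∃ σ : Lp E 2 μ, (∀ c : E, inner ℝ σ (Lp.constL 2 μ ℝ c) = 0) ∧
      ∀ y : Lp E 2 μ, inner ℝ σ y - ∫ ω, ψ (y ω) ω ∂μ ≤ - ∫ ω, ψ χ ω ∂μ := by
  set J : Lp E 2 μ → ℝ := fun y => ∫ ω, ψ (y ω) ω ∂μ with hJ
  set v : ℝ := ∫ ω, ψ χ ω ∂μ with hv
  have hJconst (c : E) : J (Lp.constL 2 μ ℝ c) = ∫ ω, ψ c ω ∂μ := by
    refine integral_congr_ae ?_
    filter_upwards [Lp.coeFn_const (μ := μ) 2 c] with ω hω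
    have : (Lp.constL 2 μ ℝ c : Lp E 2 μ) ω = c := hω
    rw [this]
  obtain ⟨f, u, hfS, hfT⟩ := geometric_hahn_banach_open
    (s := {p : Lp E 2 μ × ℝ | p.1 ∈ Set.univ ∧ J p.1 < p.2})
    (t := (LinearMap.range (Lp.constL 2 μ ℝ : E →L[ℝ] Lp E 2 μ).toLinearMap : Set (Lp E 2 μ)) ×ˢ
      {v})
    (h.convexOn_integral_L2.convex_strict_epigraph)
    (by
      simp only [Set.mem_univ, true_and]
      exact isOpen_lt ((h.continuous_integral_L2 hK).comp continuous_fst) continuous_snd)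
    ((Submodule.convex _).prod (convex_singleton v))
    (by
      rw [Set.disjoint_left]
      rintro ⟨y, t⟩ ⟨-, hlt⟩ ⟨⟨c, rfl⟩, rfl⟩
      have h1 : J (Lp.constL 2 μ ℝ c) < v := hlt
      rw [hJconst] at h1
      exact absurd (hχ c) (not_le.mpr h1))
  set β : ℝ := f (0, 1) with hβ
  have hsplit (y : Lp E 2 μ) (t : ℝ) : f (y, t) = f (y, 0) + t * β := by
    have : ((y, t) : Lp E 2 μ × ℝ) = (y, 0) + t • (0, 1) := by simp
    rw [this, map_add, map_smul, smul_eq_mul]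
  have hT (c : E) : u ≤ f (Lp.constL 2 μ ℝ c, 0) + v * β := by
    rw [← hsplit]
    exact hfT _ ⟨⟨c, rfl⟩, rfl⟩
  have hS (y : Lp E 2 μ) (t : ℝ) (ht : J y < t) : f (y, 0) + t * β < u := by
    rw [← hsplit]
    exact hfS _ ⟨trivial, ht⟩
  -- The hyperplane is not vertical: the points over `χ` at heights `v` and `v + 1` lie on opposite
  -- sides.
  have hβneg : β < 0 := by
    have h1 := hT χ
    have h2 := hS (Lp.constL 2 μ ℝ χ) (v + 1) (by rw [hJconst]; linarith)
    linarith
  have hu : u ≤ v * β := by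
    have := hT 0
    rwa [map_zero, Prod.mk_zero_zero, map_zero, zero_add] at this
  have hconst (c : E) : f (Lp.constL 2 μ ℝ c, 0) = 0 := by
    by_contra hne
    set d := f (Lp.constL 2 μ ℝ c, 0) with hd
    -- A functional bounded below on a subspace vanishes there; this multiple of `c` would give `u ≤
    -- u - 1`.
    have h1 := hT (((u - v * β - 1) / d) • c)
    have : ((Lp.constL 2 μ ℝ (((u - v * β - 1) / d) • c), 0) : Lp E 2 μ × ℝ)
        = ((u - v * β - 1) / d) • (Lp.constL 2 μ ℝ c, 0) := by simp
    rw [this, map_smul, ← hd, smul_eq_mul, div_mul_cancel₀ _ hne] at h1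
    linarith
  have hle (y : Lp E 2 μ) : f (y, 0) + J y * β ≤ v * β := by
    refine le_of_forall_pos_le_add fun ε hε => ?_
    -- The height is chosen so that multiplying by `β` costs exactly `ε`.
    have h1 := hS y (J y + ε / (-β)) (by
      have : 0 < ε / (-β) := div_pos hε (by linarith)
      linarith)
    have h2 : ε / (-β) * β = -ε := by field_simp [hβneg.ne]
    rw [add_mul, h2] at h1
    linarith
  refine ⟨(InnerProductSpace.toDual ℝ (Lp E 2 μ)).symm
    ((-β)⁻¹ • f.comp (ContinuousLinearMap.inl ℝ (Lp E 2 μ) ℝ)), fun c => ?_, fun y => ?_⟩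
  · rw [InnerProductSpace.toDual_symm_apply]
    simp only [smul_apply, ContinuousLinearMap.comp_apply, ContinuousLinearMap.inl_apply, hconst,
      smul_zero]
  · rw [InnerProductSpace.toDual_symm_apply]
    simp only [smul_apply, ContinuousLinearMap.comp_apply,
      ContinuousLinearMap.inl_apply, smul_eq_mul]
    have h1 := hle y
    have h2 : f (y, 0) ≤ (J y - v) * (-β) := by linarith
    have h3 : (-β)⁻¹ * f (y, 0) ≤ J y - v := by
      rw [inv_mul_le_iff₀ (by linarith)]
      linarith
    linarith

/-- A minimizer of the expectation of a Lipschitz convex integrand over the deterministic decisions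
admits a centred, square integrable selection of subgradients. -/
theorem exists_centred_subgradient (h : LipschitzConvexIntegrand μ K ψ) (hK : 0 ≤ K) {χ : E}
    (hχ : ∀ y, ∫ ω, ψ χ ω ∂μ ≤ ∫ ω, ψ y ω ∂μ) :
    ∃ σ : Lp E 2 μ, ∫ ω, σ ω ∂μ = 0 ∧
      ∀ᵐ ω ∂μ, ∀ y, inner ℝ (σ ω) y - ψ y ω ≤ inner ℝ (σ ω) χ - ψ χ ω := by
  obtain ⟨σ, hσ0, hσ⟩ := h.exists_L2_multiplier hK hχ
  have hσi := integrable_coe_L2 σ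
  refine ⟨σ, ?_, ?_⟩
  · refine ext_inner_left ℝ fun c => ?_
    rw [inner_zero_right, ← integral_inner hσi, ← hσ0 c, L2.inner_def]
    refine integral_congr_ae ?_
    filter_upwards [Lp.coeFn_const (μ := μ) 2 c] with ω hω
    have : (Lp.constL 2 μ ℝ c : Lp E 2 μ) ω = c := hω
    rw [this, real_inner_comm]
  -- Localization: testing the integral inequality with `χ` moved to `q` on an arbitrary measurable
  -- set `s` gives the inequality of integrals over each `s`, hence almost everywhere.
  · have key (q : E) : ∀ᵐ ω ∂μ, inner ℝ (q - χ) (σ ω) ≤ ψ q ω - ψ χ ω := by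
      refine ae_le_of_forall_setIntegral_le (hσi.const_inner (q - χ))
        ((h.integrable q).sub (h.integrable χ)) fun s hs hμs => ?_
      have h1 := hσ (Lp.constL 2 μ ℝ χ + indicatorConstLp 2 hs hμs.ne (q - χ))
      rw [inner_add_right, hσ0, zero_add, real_inner_comm,
        L2.inner_indicatorConstLp_eq_inner_setIntegral,
        ← integral_inner hσi.integrableOn] at h1
      have h2 : ∫ ω, ψ ((Lp.constL 2 μ ℝ χ + indicatorConstLp 2 hs hμs.ne (q - χ) :
          Lp E 2 μ) ω) ω ∂μ = ∫ ω, (ψ χ ω + s.indicator (ψ q - ψ χ) ω) ∂μ := by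
        refine integral_congr_ae ?_
        filter_upwards [Lp.coeFn_const (μ := μ) 2 χ, Lp.coeFn_add (Lp.constL 2 μ ℝ χ)
          (indicatorConstLp 2 hs hμs.ne (q - χ)),
          indicatorConstLp_coeFn (p := 2) (hs := hs) (hμs := hμs.ne) (c := q - χ)] with ω e1 e2 e3
        have e1' : (Lp.constL 2 μ ℝ χ : Lp E 2 μ) ω = χ := e1
        rw [e2, Pi.add_apply, e1', e3]
        by_cases hω : ω ∈ s <;> simp [hω]
      rw [h2, integral_add (h.integrable χ)
        (((h.integrable q).sub (h.integrable χ)).indicator hs), integral_indicator hs] at h1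
      simp only [Pi.sub_apply] at h1 ⊢
      linarith
    have : SecondCountableTopology E := by
      have := FiniteDimensional.proper_real E
      infer_instance
    -- The null set in `key` depends on `q`; a countable dense set of `q` and continuity provide one
    -- null set for all `y`.
    obtain ⟨D, hDc, hDd⟩ := TopologicalSpace.exists_countable_dense E
    filter_upwards [(ae_ball_iff hDc).2 fun q _ => key q] with ω hω y
    have hcl : IsClosed {q : E | inner ℝ (q - χ) (σ ω) ≤ ψ q ω - ψ χ ω} :=
      isClosed_le (by fun_prop) ((h.continuous ω).sub continuous_const)
    have h1 : inner ℝ (y - χ) (σ ω) ≤ ψ y ω - ψ χ ω :=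
      hcl.closure_subset_iff.2 (fun q hq => hω q hq) (hDd y)
    rw [inner_sub_left, real_inner_comm, real_inner_comm (σ ω) χ] at h1
    linarith

end Duality

end LipschitzConvexIntegrand

/-! ### Extended-real expectations and monotone convergence. -/

section Expectation

variable {Ω : Type*} [MeasurableSpace Ω] {μ : Measure Ω}

theorem eexp_mono {g₁ g₂ : Ω → EReal} (h : g₁ ≤ᵐ[μ] g₂) : eexp μ g₁ ≤ eexp μ g₂ := by
  have hpos : ∫⁻ ω, (g₁ ω).toENNReal ∂μ ≤ ∫⁻ ω, (g₂ ω).toENNReal ∂μ :=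
    lintegral_mono_ae (h.mono fun ω hω => EReal.toENNReal_le_toENNReal hω)
  have hneg : ∫⁻ ω, (-g₂ ω).toENNReal ∂μ ≤ ∫⁻ ω, (-g₁ ω).toENNReal ∂μ :=
    lintegral_mono_ae (h.mono fun ω hω =>
      EReal.toENNReal_le_toENNReal (EReal.neg_le_neg_iff.2 hω))
  unfold eexp
  by_cases h2 : ∫⁻ ω, (g₂ ω).toENNReal ∂μ = ⊤
  · rw [if_pos h2]
    exact le_top
  · rw [if_neg h2, if_neg (ne_top_of_le_ne_top h2 hpos)]
    exact EReal.sub_le_sub (EReal.coe_ennreal_le_coe_ennreal_iff.2 hpos)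
      (EReal.coe_ennreal_le_coe_ennreal_iff.2 hneg)

theorem eexp_congr {g₁ g₂ : Ω → EReal} (h : g₁ =ᵐ[μ] g₂) : eexp μ g₁ = eexp μ g₂ :=
  le_antisymm (eexp_mono h.le) (eexp_mono h.symm.le)

theorem eexp_coe {f : Ω → ℝ} (hf : Integrable f μ) :
    eexp μ (fun ω => (f ω : EReal)) = ((∫ ω, f ω ∂μ : ℝ) : EReal) := by
  have hpos : ∫⁻ ω, ENNReal.ofReal (f ω) ∂μ ≠ ⊤ := hf.lintegral_lt_top.ne
  have hneg : ∫⁻ ω, ENNReal.ofReal (-f ω) ∂μ ≠ ⊤ := hf.neg.lintegral_lt_top.ne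
  unfold eexp
  simp only [← EReal.coe_neg, EReal.toENNReal_of_ne_top (EReal.coe_ne_top _), EReal.toReal_coe]
  rw [if_neg hpos, integral_eq_lintegral_pos_part_sub_lintegral_neg_part hf, EReal.coe_sub,
    ← EReal.toReal_coe_ennreal, ← EReal.toReal_coe_ennreal, EReal.coe_toReal, EReal.coe_toReal] <;>
    simp [hpos, hneg]

/-- A measurable function that is bounded below and whose positive part has a finite expectation
is almost surely equal to an integrable real function. -/
theorem exists_integrable_ae_eq_coe [IsFiniteMeasure μ] {g : Ω → EReal} (hg : Measurable g) {C : ℝ}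
    (hC : ∀ ω, ((-C : ℝ) : EReal) ≤ g ω) (hfin : ∫⁻ ω, (g ω).toENNReal ∂μ ≠ ⊤) :
    ∃ f : Ω → ℝ, Integrable f μ ∧ g =ᵐ[μ] fun ω => (f ω : EReal) := by
  have hlt := ae_lt_top hg.ereal_toENNReal hfin
  have heq : g =ᵐ[μ] fun ω => ((g ω).toReal : EReal) := by
    filter_upwards [hlt] with ω hω
    refine (EReal.coe_toReal ?_ ?_).symm
    · intro h
      simp [h] at hω
    · exact ((EReal.bot_lt_coe _).trans_le (hC ω)).ne'
  refine ⟨fun ω => (g ω).toReal, ?_, heq⟩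
  have hbd : Integrable (fun ω => (g ω).toENNReal.toReal + |C|) μ :=
    (integrable_toReal_of_lintegral_ne_top hg.ereal_toENNReal.aemeasurable hfin).add
      (integrable_const _)
  refine hbd.mono' hg.ereal_toReal.aestronglyMeasurable ?_
  filter_upwards [heq] with ω hω
  have h1 := hC ω
  rw [hω, EReal.coe_le_coe_iff] at h1
  have h2 : (g ω).toENNReal.toReal = max (g ω).toReal 0 := by
    rw [EReal.toENNReal_of_ne_top (by rw [hω]; exact EReal.coe_ne_top _), ENNReal.toReal_ofReal']
  rw [h2, Real.norm_eq_abs, abs_le]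
  have := le_abs_self C
  have := abs_nonneg C
  have := le_max_left (g ω).toReal 0
  have := le_max_right (g ω).toReal 0
  constructor <;> linarith

/-- Monotone convergence for an increasing sequence of integrable functions with bounded
expectations. -/
theorem eexp_iSup_le [IsProbabilityMeasure μ] {f : ℕ → Ω → ℝ} (hf : ∀ j, Integrable (f j) μ)
    (hmeas : ∀ j, Measurable (f j)) (hmono : Monotone f) {C s : ℝ} (hC : ∀ j ω, -C ≤ f j ω)
    (hs : ∀ j, ∫ ω, f j ω ∂μ ≤ s) : eexp μ (fun ω => ⨆ j, (f j ω : EReal)) ≤ s := by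
  set g : Ω → EReal := fun ω => ⨆ j, (f j ω : EReal) with hg
  have hgm : Measurable g := Measurable.iSup fun j => (hmeas j).coe_real_ereal
  have hgC (ω : Ω) : ((-(|C|) : ℝ) : EReal) ≤ g ω :=
    le_trans (EReal.coe_le_coe_iff.2 ((neg_le_neg (le_abs_self C)).trans (hC 0 ω)))
      (le_iSup (fun j => (f j ω : EReal)) 0)
  have hpos : ∫⁻ ω, (g ω).toENNReal ∂μ ≤ ENNReal.ofReal (s + |C|) := by
    -- The shift by `|C|` makes the sequence nonnegative, as monotone convergence of lower integrals
    -- requires.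
    calc ∫⁻ ω, (g ω).toENNReal ∂μ ≤ ∫⁻ ω, ⨆ j, ENNReal.ofReal (f j ω + |C|) ∂μ := by
          refine lintegral_mono fun ω => ?_
          rw [← EReal.toENNReal_coe (x := ⨆ j, ENNReal.ofReal (f j ω + |C|))]
          refine EReal.toENNReal_le_toENNReal (iSup_le fun j => ?_)
          calc (f j ω : EReal) ≤ ((f j ω + |C| : ℝ) : EReal) :=
                EReal.coe_le_coe_iff.2 (by linarith [abs_nonneg C])
            _ ≤ ((ENNReal.ofReal (f j ω + |C|) : ℝ≥0∞) : EReal) := by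
                rw [EReal.coe_ennreal_ofReal]
                exact EReal.coe_le_coe_iff.2 (le_max_left _ _)
            _ ≤ _ := EReal.coe_ennreal_le_coe_ennreal_iff.2
                (le_iSup (fun j => ENNReal.ofReal (f j ω + |C|)) j)
      _ = ⨆ j, ∫⁻ ω, ENNReal.ofReal (f j ω + |C|) ∂μ :=
          lintegral_iSup (fun j => ((hmeas j).add_const _).ennreal_ofReal)
            fun i j hij ω => ENNReal.ofReal_le_ofReal (by have := hmono hij ω; linarith)
      _ ≤ ENNReal.ofReal (s + |C|) := by
          refine iSup_le fun j => ?_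
          have hnonneg : 0 ≤ᵐ[μ] fun ω => f j ω + |C| := Filter.Eventually.of_forall fun ω => by
            have := hC j ω
            have := le_abs_self C
            simp only [Pi.zero_apply]
            linarith
          have hint : Integrable (fun ω => f j ω + |C|) μ := (hf j).add (integrable_const _)
          rw [← ofReal_integral_eq_lintegral_ofReal hint hnonneg,
            integral_add (hf j) (integrable_const _), integral_const, probReal_univ, one_smul]
          exact ENNReal.ofReal_le_ofReal (by linarith [hs j])
  obtain ⟨F, hF, hgF⟩ := exists_integrable_ae_eq_coe hgm hgC
    (ne_top_of_le_ne_top ENNReal.ofReal_ne_top hpos)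
  rw [eexp_congr hgF, eexp_coe hF, EReal.coe_le_coe_iff]
  refine le_of_tendsto' (integral_tendsto_of_tendsto_of_monotone hf hF
    (Filter.Eventually.of_forall fun ω i j hij => hmono hij ω) ?_) hs
  filter_upwards [hgF] with ω hω
  rw [← EReal.tendsto_coe, ← hω]
  exact tendsto_atTop_iSup fun i j hij => EReal.coe_le_coe_iff.2 (hmono hij ω)

end Expectation

/-- On a compact set, an increasing sequence of continuous functions whose minima are all at most
`t` has a common point where all of them are at most `t`. -/
theorem IsCompact.exists_forall_le_of_monotone {X : Type*} [TopologicalSpace X] [T2Space X]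
    {S : Set X} (hS : IsCompact S) {G : ℕ → X → ℝ} (hG : ∀ j, Continuous (G j))
    (hmono : ∀ j, ∀ x ∈ S, G j x ≤ G (j + 1) x) {t : ℝ} (h : ∀ j, ∃ x ∈ S, G j x ≤ t) :
    ∃ x ∈ S, ∀ j, G j x ≤ t := by
  have hcl (j : ℕ) : IsClosed (S ∩ {x | G j x ≤ t}) :=
    hS.isClosed.inter (isClosed_le (hG j) continuous_const)
  obtain ⟨x, hx⟩ := IsCompact.nonempty_iInter_of_sequence_nonempty_isCompact_isClosed
    (fun j => S ∩ {x | G j x ≤ t})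
    (fun j x hx => ⟨hx.1, (hmono j x hx.1).trans hx.2⟩) (fun j => h j)
    (hS.inter_right (isClosed_le (hG 0) continuous_const)) hcl
  rw [Set.mem_iInter] at hx
  exact ⟨x, (hx 0).1, fun j => (hx j).2⟩

/-! ### Lipschitz penalization of a two-stage convex problem. -/

section Envelope

variable {Ω E V : Type*} [MeasurableSpace Ω] [NormedAddCommGroup E] [NormedSpace ℝ E]
  [NormedAddCommGroup V] [NormedSpace ℝ V]

/-- A two-stage convex problem: the decisions `(y, v)` range over a compact convex set `W`, have the
cost `F`, and have to satisfy the random constraint `p (y, v) ω = 0`. -/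
structure PenalizedProblem (W : Set (E × V)) (F : E × V → ℝ) (p : E × V → Ω → ℝ) (B : ℝ) :
    Prop where
  compact : IsCompact W
  convex : Convex ℝ W
  nonempty : W.Nonempty
  cost_continuous : Continuous F
  cost_convex : ConvexOn ℝ W F
  pen_continuous : ∀ ω, Continuous fun w => p w ω
  pen_convex : ∀ ω, ConvexOn ℝ W fun w => p w ω
  pen_nonneg : ∀ w ω, 0 ≤ p w ω
  pen_le : ∀ w ∈ W, ∀ ω, p w ω ≤ B
  pen_measurable : ∀ w, Measurable (p w)

/-- The cost in which the coupling `w.1 = y` and the random constraint are penalized. -/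
noncomputable def penalizedCost (F : E × V → ℝ) (p : E × V → Ω → ℝ) (k : ℕ) (y : E) (ω : Ω)
    (w : E × V) : ℝ :=
  F w + (k + 1) * (‖y - w.1‖ + p w ω)

/-- The minimal penalized cost. -/
noncomputable def penalizedValue (W : Set (E × V)) (F : E × V → ℝ) (p : E × V → Ω → ℝ) (k : ℕ) (y : E)
    (ω : Ω) : ℝ :=
  ⨅ w : W, penalizedCost F p k y ω w

namespace PenalizedProblem

variable {W : Set (E × V)} {F : E × V → ℝ} {p : E × V → Ω → ℝ} {B : ℝ}

theorem continuous_penalizedCost (h : PenalizedProblem W F p B) (k : ℕ) (y : E) (ω : Ω) :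
    Continuous (penalizedCost F p k y ω) := by
  have := h.cost_continuous
  have := h.pen_continuous ω
  unfold penalizedCost
  fun_prop

theorem penalizedValue_le (h : PenalizedProblem W F p B) (k : ℕ) (y : E) (ω : Ω) {w : E × V}
    (hw : w ∈ W) : penalizedValue W F p k y ω ≤ penalizedCost F p k y ω w := by
  refine ciInf_le (f := fun w : W => penalizedCost F p k y ω w) ?_ ⟨w, hw⟩
  have := h.compact.bddBelow_image (h.continuous_penalizedCost k y ω).continuousOn
  rwa [Set.image_eq_range] at this

theorem exists_eq_penalizedValue (h : PenalizedProblem W F p B) (k : ℕ) (y : E) (ω : Ω) :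
    ∃ w ∈ W, penalizedCost F p k y ω w = penalizedValue W F p k y ω := by
  obtain ⟨w, hw, hmin⟩ := h.compact.exists_isMinOn h.nonempty
    (h.continuous_penalizedCost k y ω).continuousOn
  have := h.nonempty.to_subtype
  exact ⟨w, hw, le_antisymm (le_ciInf fun w' => hmin w'.2) (h.penalizedValue_le k y ω hw)⟩

theorem penalizedCost_mono (h : PenalizedProblem W F p B) (y : E) (ω : Ω) (w : E × V) {i j : ℕ}
    (hij : i ≤ j) : penalizedCost F p i y ω w ≤ penalizedCost F p j y ω w := by
  have : (i : ℝ) ≤ j := by exact_mod_cast hij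
  have := h.pen_nonneg w ω
  unfold penalizedCost
  gcongr

theorem penalizedValue_mono (h : PenalizedProblem W F p B) (y : E) (ω : Ω) :
    Monotone fun k => penalizedValue W F p k y ω := by
  intro i j hij
  obtain ⟨w, hw, hwe⟩ := h.exists_eq_penalizedValue j y ω
  exact (h.penalizedValue_le i y ω hw).trans ((h.penalizedCost_mono y ω w hij).trans hwe.le)

/-- The point `y` enters only through `(k + 1) * ‖y - w.1‖`, so a minimizer for `z` is a good
candidate for `y`. -/
theorem abs_penalizedValue_sub_le (h : PenalizedProblem W F p B) (k : ℕ) (ω : Ω) (y z : E) :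
    |penalizedValue W F p k y ω - penalizedValue W F p k z ω| ≤ (k + 1) * ‖y - z‖ := by
  have key (y z : E) :
      penalizedValue W F p k y ω - penalizedValue W F p k z ω ≤ (k + 1) * ‖y - z‖ := by
    obtain ⟨w, hw, hwe⟩ := h.exists_eq_penalizedValue k z ω
    have h1 := h.penalizedValue_le k y ω hw
    rw [← hwe]
    have h2 : (k + 1 : ℝ) * ‖y - w.1‖ ≤ (k + 1) * (‖y - z‖ + ‖z - w.1‖) := by
      gcongr
      exact norm_sub_le_norm_sub_add_norm_sub y z w.1
    unfold penalizedCost at h1 ⊢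
    linarith
  rw [abs_le]
  have := key z y
  rw [norm_sub_rev] at this
  exact ⟨by linarith, key y z⟩

/-- Partial minimization of a jointly convex function over a convex set: the convex combination of
two minimizers is a competitor. -/
theorem convexOn_penalizedValue (h : PenalizedProblem W F p B) (k : ℕ) (ω : Ω) :
    ConvexOn ℝ Set.univ fun y => penalizedValue W F p k y ω := by
  refine ⟨convex_univ, fun y _ z _ a b ha hb hab => ?_⟩
  obtain ⟨w, hw, hwe⟩ := h.exists_eq_penalizedValue k y ω
  obtain ⟨w', hw', hwe'⟩ := h.exists_eq_penalizedValue k z ω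
  refine (h.penalizedValue_le k _ ω (h.convex hw hw' ha hb hab)).trans ?_
  simp only
  rw [← hwe, ← hwe']
  have h1 := h.cost_convex.2 hw hw' ha hb hab
  have h2 := (h.pen_convex ω).2 hw hw' ha hb hab
  have h3 : ‖a • y + b • z - (a • w + b • w').1‖ ≤ a * ‖y - w.1‖ + b * ‖z - w'.1‖ := by
    have : a • y + b • z - (a • w + b • w').1 = a • (y - w.1) + b • (z - w'.1) := by
      simp only [Prod.fst_add, Prod.smul_fst, smul_sub]
      abel
    rw [this]
    refine (norm_add_le _ _).trans ?_
    rw [norm_smul, norm_smul, Real.norm_of_nonneg ha, Real.norm_of_nonneg hb]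
  simp only [smul_eq_mul] at h1 h2 ⊢
  unfold penalizedCost
  have h4 := mul_le_mul_of_nonneg_left (add_le_add h3 h2) (by positivity : (0 : ℝ) ≤ k + 1)
  linarith

/-- By continuity in `w`, the infimum over the compact, hence separable, set `W` may be taken over a
countable dense subset. -/
theorem measurable_penalizedValue (h : PenalizedProblem W F p B) (k : ℕ) (y : E) :
    Measurable (penalizedValue W F p k y) := by
  have := h.compact.isSeparable.separableSpace
  obtain ⟨D, hDc, hDd⟩ := TopologicalSpace.exists_countable_dense W
  refine measurable_of_Iio fun t => ?_
  have : penalizedValue W F p k y ⁻¹' Set.Iio t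
      = ⋃ w ∈ D, {ω | penalizedCost F p k y ω (w : E × V) < t} := by
    ext ω
    simp only [Set.mem_preimage, Set.mem_Iio, Set.mem_iUnion, Set.mem_ofPred_eq, exists_prop]
    constructor
    · intro hlt
      obtain ⟨w, hw, hwe⟩ := h.exists_eq_penalizedValue k y ω
      obtain ⟨d, hd, hdD⟩ := hDd.inter_open_nonempty
        {w : W | penalizedCost F p k y ω (w : E × V) < t}
        (isOpen_lt ((h.continuous_penalizedCost k y ω).comp continuous_subtype_val)
          continuous_const) ⟨⟨w, hw⟩, by rw [Set.mem_ofPred_eq, hwe]; exact hlt⟩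
      exact ⟨d, hdD, hd⟩
    · rintro ⟨w, -, hw⟩
      exact (h.penalizedValue_le k y ω w.2).trans_lt hw
  rw [this]
  refine MeasurableSet.biUnion hDc fun w _ => measurableSet_lt ?_ measurable_const
  have := h.pen_measurable w
  unfold penalizedCost
  fun_prop

theorem exists_forall_abs_cost_le (h : PenalizedProblem W F p B) :
    ∃ C, 0 ≤ C ∧ ∀ w ∈ W, |F w| ≤ C ∧ ‖w.1‖ ≤ C := by
  obtain ⟨C, hC⟩ := h.compact.exists_bound_of_continuousOn h.cost_continuous.continuousOn
  obtain ⟨R, hR⟩ := h.compact.exists_bound_of_continuousOn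
    (continuous_fst (X := E) (Y := V)).continuousOn
  obtain ⟨w, hw⟩ := h.nonempty
  exact ⟨max C R, (norm_nonneg _).trans ((hC w hw).trans (le_max_left _ _)),
    fun w hw => ⟨(hC w hw).trans (le_max_left _ _), (hR w hw).trans (le_max_right _ _)⟩⟩

/-- Uniform coercivity of the penalized values. -/
theorem le_penalizedValue (h : PenalizedProblem W F p B) {C : ℝ}
    (hC : ∀ w ∈ W, |F w| ≤ C ∧ ‖w.1‖ ≤ C) (k : ℕ) (y : E) (ω : Ω) :
    -C ≤ penalizedValue W F p k y ω ∧ ‖y‖ - 2 * C ≤ penalizedValue W F p k y ω := by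
  -- Monotonicity reduces to `k = 0`, where the penalty has weight one; then `F w ≥ -C` and `‖y -
  -- w.1‖ ≥ ‖y‖ - C` give both bounds.
  have h0 := h.penalizedValue_mono y ω (Nat.zero_le k)
  obtain ⟨w, hw, hwe⟩ := h.exists_eq_penalizedValue 0 y ω
  simp only [← hwe] at h0
  have h1 := neg_le_of_abs_le (hC w hw).1
  have h2 := (hC w hw).2
  have h3 := h.pen_nonneg w ω
  have h4 := norm_nonneg (y - w.1)
  have h5 := norm_sub_norm_le y w.1
  have h6 : penalizedCost F p 0 y ω w = F w + (‖y - w.1‖ + p w ω) := by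
    simp [penalizedCost]
  constructor <;> linarith

theorem lipschitzConvexIntegrand (h : PenalizedProblem W F p B) (μ : Measure Ω)
    [IsFiniteMeasure μ] (k : ℕ) :
    LipschitzConvexIntegrand μ (k + 1) (penalizedValue W F p k) where
  lip := h.abs_penalizedValue_sub_le k
  convex := h.convexOn_penalizedValue k
  measurable := h.measurable_penalizedValue k
  integrable y := by
    obtain ⟨C, hC0, hC⟩ := h.exists_forall_abs_cost_le
    obtain ⟨w, hw⟩ := h.nonempty
    refine Integrable.of_bound (h.measurable_penalizedValue k y).aestronglyMeasurable
      (C + (k + 1) * (‖y - w.1‖ + B)) (Filter.Eventually.of_forall fun ω => ?_)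
    have h1 := (h.le_penalizedValue hC k y ω).1
    have h2 := h.penalizedValue_le k y ω hw
    have h3 : (k + 1 : ℝ) * (‖y - w.1‖ + p w ω) ≤ (k + 1) * (‖y - w.1‖ + B) := by
      gcongr
      exact h.pen_le w hw ω
    have h4 : 0 ≤ (k + 1 : ℝ) * (‖y - w.1‖ + p w ω) := by
      have := h.pen_nonneg w ω
      positivity
    have h5 := le_of_abs_le (hC w hw).1
    unfold penalizedCost at h2
    rw [Real.norm_eq_abs, abs_le]
    constructor <;> linarith

theorem exists_isMinimizer [FiniteDimensional ℝ E] (h : PenalizedProblem W F p B) (μ : Measure Ω)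
    [IsProbabilityMeasure μ] (k : ℕ) :
    ∃ χ, ∀ y, ∫ ω, penalizedValue W F p k χ ω ∂μ ≤ ∫ ω, penalizedValue W F p k y ω ∂μ := by
  have := FiniteDimensional.proper_real E
  have hL := h.lipschitzConvexIntegrand μ k
  obtain ⟨C, -, hC⟩ := h.exists_forall_abs_cost_le
  refine hL.continuous_integral.exists_forall_le (Filter.tendsto_atTop_mono (fun y => ?_)
    (Filter.tendsto_atTop_add_const_right _ (-(2 * C)) (tendsto_norm_cocompact_atTop (E := E))))
  have := integral_mono (μ := μ) (integrable_const (‖y‖ + -(2 * C))) (hL.integrable y) fun ω => by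
    have := (h.le_penalizedValue hC k y ω).2
    simp only
    linarith
  rwa [integral_const, probReal_univ, one_smul] at this

/-- The penalized values increase to the value of the constrained problem. -/
theorem iSup_penalizedValue (h : PenalizedProblem W F p B) {φ : E → Ω → EReal}
    (hle : ∀ w ∈ W, ∀ ω, p w ω = 0 → φ w.1 ω ≤ F w)
    (hlt : ∀ y ω (t : EReal), φ y ω < t → ∃ w ∈ W, w.1 = y ∧ p w ω = 0 ∧ (F w : EReal) < t)
    (y : E) (ω : Ω) : ⨆ k, (penalizedValue W F p k y ω : EReal) = φ y ω := by
  refine le_antisymm (iSup_le fun k => le_of_forall_gt fun t ht => ?_)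
    (EReal.le_of_forall_lt_iff_le.1 fun t ht => ?_)
  · obtain ⟨w, hw, rfl, hp, hwt⟩ := hlt y ω t ht
    refine lt_of_le_of_lt (EReal.coe_le_coe_iff.2 ((h.penalizedValue_le k w.1 ω hw).trans ?_)) hwt
    simp [penalizedCost, hp]
  -- Compactness replaces the minimizers, which vary with the penalty, by one `w` whose penalized
  -- costs are all at most `t`.
  · obtain ⟨w, hw, hwt⟩ := h.compact.exists_forall_le_of_monotone
      (h.continuous_penalizedCost · y ω) (fun j w _ => h.penalizedCost_mono y ω w j.le_succ)
      (t := t) fun j => by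
        obtain ⟨w, hw, hwe⟩ := h.exists_eq_penalizedValue j y ω
        refine ⟨w, hw, hwe.le.trans (EReal.coe_le_coe_iff.1 ?_)⟩
        exact (le_iSup (fun k => (penalizedValue W F p k y ω : EReal)) j).trans ht.le
    have hp0 := h.pen_nonneg w ω
    have hn0 := norm_nonneg (y - w.1)
    -- A positive penalty would make the costs of `w` unbounded in `k`, so `w` is feasible and lies
    -- over `y`.
    have hzero : ‖y - w.1‖ + p w ω = 0 := by
      by_contra hne
      have hpos : 0 < ‖y - w.1‖ + p w ω := lt_of_le_of_ne (by positivity) (Ne.symm hne)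
      obtain ⟨n, hn⟩ := exists_nat_gt ((t - F w) / (‖y - w.1‖ + p w ω))
      rw [div_lt_iff₀ hpos] at hn
      have := hwt n
      unfold penalizedCost at this
      linarith
    have hy : y = w.1 := sub_eq_zero.1 (norm_eq_zero.1 (by linarith))
    have hF := hwt 0
    unfold penalizedCost at hF
    rw [hzero, mul_zero, add_zero] at hF
    rw [hy]
    exact (hle w hw ω (by linarith)).trans (EReal.coe_le_coe_iff.2 hF)

end PenalizedProblem

end Envelope

/-! ### Passage from the penalized problems to the constrained one. -/

namespace PenalizedProblem

section Duality

variable {Ω E V : Type*} [MeasurableSpace Ω] [NormedAddCommGroup E] [InnerProductSpace ℝ E]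
  [FiniteDimensional ℝ E] [NormedAddCommGroup V] [NormedSpace ℝ V]
  {W : Set (E × V)} {F : E × V → ℝ} {p : E × V → Ω → ℝ} {B : ℝ} {φ : E → Ω → EReal}
  (μ : Measure Ω) [IsProbabilityMeasure μ]

omit [FiniteDimensional ℝ E] in
theorem exists_integrable_ae_eq (h : PenalizedProblem W F p B)
    (hφ : ∀ y ω, ⨆ k, (penalizedValue W F p k y ω : EReal) = φ y ω) {χ : E}
    (hχ : ∫⁻ ω, (φ χ ω).toENNReal ∂μ ≠ ⊤) :
    ∃ f : Ω → ℝ, Integrable f μ ∧ φ χ =ᵐ[μ] fun ω => (f ω : EReal) := by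
  obtain ⟨C, -, hC⟩ := h.exists_forall_abs_cost_le
  have hmeas : Measurable (φ χ) := by
    have : φ χ = fun ω => ⨆ k, (penalizedValue W F p k χ ω : EReal) :=
      funext fun ω => (hφ χ ω).symm
    rw [this]
    exact Measurable.iSup fun k => (h.measurable_penalizedValue k χ).coe_real_ereal
  refine exists_integrable_ae_eq_coe hmeas (C := C) (fun ω => ?_) hχ
  rw [← hφ]
  exact (EReal.coe_le_coe_iff.2 (h.le_penalizedValue hC 0 χ ω).1).trans
    (le_iSup (fun k => (penalizedValue W F p k χ ω : EReal)) 0)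

omit [IsProbabilityMeasure μ] in
-- Centring makes the linear term vanish in expectation at every deterministic decision.
theorem eexp_inner_sub {σ : Ω → E} (hσ : Integrable σ μ) (hσ0 : ∫ ω, σ ω ∂μ = 0) {f : Ω → ℝ}
    (hf : Integrable f μ) (χ : E) :
    eexp μ (fun ω => ((inner ℝ (σ ω) χ - f ω : ℝ) : EReal)) = -((∫ ω, f ω ∂μ : ℝ) : EReal) := by
  have hinner : ∫ ω, inner ℝ (σ ω) χ ∂μ = 0 := by
    simp only [real_inner_comm χ]
    rw [integral_inner hσ, hσ0, inner_zero_right]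
  have hint : Integrable (fun ω => inner ℝ (σ ω) χ - f ω) μ := (hσ.inner_const χ).sub hf
  rw [eexp_coe hint, integral_sub (hσ.inner_const χ) hf, hinner, zero_sub, EReal.coe_neg]

/-- The Fenchel–Young inequality at `y = χ`, integrated. If the positive part of `φ χ` has infinite
expectation the right side is `⊤`; otherwise `φ χ` is almost surely an integrable real function. -/
theorem weak_duality (h : PenalizedProblem W F p B)
    (hφ : ∀ y ω, ⨆ k, (penalizedValue W F p k y ω : EReal) = φ y ω)
    {σ : Ω → E} (hσ : Integrable σ μ) (hσ0 : ∫ ω, σ ω ∂μ = 0) (χ : E) :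
    -eexp μ (fun ω => ⨆ y : E, ((inner ℝ (σ ω) y : ℝ) : EReal) - φ y ω) ≤ eexp μ (φ χ) := by
  by_cases hχ : ∫⁻ ω, (φ χ ω).toENNReal ∂μ = ⊤
  · rw [eexp, eexp, if_pos hχ]
    exact le_top
  obtain ⟨f, hf, hfφ⟩ := h.exists_integrable_ae_eq μ hφ hχ
  rw [eexp_congr hfφ, eexp_coe hf, EReal.neg_le, ← eexp_inner_sub μ hσ hσ0 hf χ]
  refine eexp_mono ?_
  filter_upwards [hfφ] with ω hω
  refine le_trans (le_of_eq ?_)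
    (le_iSup (fun y : E => ((inner ℝ (σ ω) y : ℝ) : EReal) - φ y ω) χ)
  rw [hω, EReal.coe_sub]

/-- A multiplier which attains the value of a penalized problem. -/
theorem exists_multiplier (h : PenalizedProblem W F p B)
    (hφ : ∀ y ω, ⨆ k, (penalizedValue W F p k y ω : EReal) = φ y ω) (k : ℕ) {χ : E}
    (hχ : ∀ y, ∫ ω, penalizedValue W F p k χ ω ∂μ ≤ ∫ ω, penalizedValue W F p k y ω ∂μ) :
    ∃ σ : Lp E 1 μ, ∫ ω, σ ω ∂μ = 0 ∧ ((∫ ω, penalizedValue W F p k χ ω ∂μ : ℝ) : EReal) ≤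
      -eexp μ (fun ω => ⨆ y : E, ((inner ℝ (σ ω) y : ℝ) : EReal) - φ y ω) := by
  have hL := h.lipschitzConvexIntegrand μ k
  obtain ⟨τ, hτ0, hτ⟩ := hL.exists_centred_subgradient (by positivity) hχ
  have hτi := LipschitzConvexIntegrand.integrable_coe_L2 τ
  have hτ1 : MemLp τ 1 μ := (Lp.memLp τ).mono_exponent (by norm_num)
  refine ⟨hτ1.toLp τ, ?_, ?_⟩
  · rw [integral_congr_ae hτ1.coeFn_toLp, hτ0]
  rw [EReal.le_neg, ← eexp_inner_sub μ hτi hτ0 (hL.integrable χ) χ]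
  refine eexp_mono ?_
  filter_upwards [hτ1.coeFn_toLp, hτ] with ω h1 h2
  rw [h1]
  -- The penalized value lies below `φ`, so the conjugate of `φ` lies below the penalized conjugate,
  -- which at `σ ω` is attained at `χ`.
  refine iSup_le fun y => le_trans ?_ (EReal.coe_le_coe_iff.2 (h2 y))
  rw [← hφ, EReal.coe_sub]
  refine EReal.sub_le_sub le_rfl ?_
  exact le_iSup (fun k => (penalizedValue W F p k y ω : EReal)) k

/-- Coercivity uniform in `k` confines all near-optimal decisions to one ball; compactness gives a
single `χ` good for every `k`, and monotone convergence passes to `φ`. -/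
theorem exists_eexp_le (h : PenalizedProblem W F p B)
    (hφ : ∀ y ω, ⨆ k, (penalizedValue W F p k y ω : EReal) = φ y ω) {s : ℝ}
    (hs : ∀ k : ℕ, ∃ χ, ∫ ω, penalizedValue W F p k χ ω ∂μ ≤ s) : ∃ χ, eexp μ (φ χ) ≤ s := by
  have := FiniteDimensional.proper_real E
  have hL (k : ℕ) := h.lipschitzConvexIntegrand μ k
  obtain ⟨C, -, hC⟩ := h.exists_forall_abs_cost_le
  have hmono (χ : E) {i j : ℕ} (hij : i ≤ j) :
      ∫ ω, penalizedValue W F p i χ ω ∂μ ≤ ∫ ω, penalizedValue W F p j χ ω ∂μ :=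
    integral_mono ((hL i).integrable χ) ((hL j).integrable χ)
      fun ω => h.penalizedValue_mono χ ω hij
  obtain ⟨χ, -, hχ⟩ := (isCompact_closedBall (0 : E) (s + 2 * C)).exists_forall_le_of_monotone
    (G := fun k χ => ∫ ω, penalizedValue W F p k χ ω ∂μ) (fun k => (hL k).continuous_integral)
    (fun j χ _ => hmono χ j.le_succ) (t := s) fun j => by
      obtain ⟨χ, hχ⟩ := hs j
      refine ⟨χ, ?_, hχ⟩
      have := integral_mono (μ := μ) (integrable_const (‖χ‖ - 2 * C)) ((hL j).integrable χ)
        fun ω => (h.le_penalizedValue hC j χ ω).2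
      rw [integral_const, probReal_univ, one_smul] at this
      rw [mem_closedBall_zero_iff]
      linarith
  refine ⟨χ, ?_⟩
  have : φ χ = fun ω => ⨆ k, (penalizedValue W F p k χ ω : EReal) :=
    funext fun ω => (hφ χ ω).symm
  rw [this]
  exact eexp_iSup_le (fun k => (hL k).integrable χ) (fun k => (hL k).measurable χ)
    (fun i j hij ω => h.penalizedValue_mono χ ω hij)
    (fun k ω => (h.le_penalizedValue hC k χ ω).1) hχ

/-- Strong duality between the deterministic decisions and the centred integrable multipliers. -/
theorem strong_duality (h : PenalizedProblem W F p B)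
    (hφ : ∀ y ω, ⨆ k, (penalizedValue W F p k y ω : EReal) = φ y ω) :
    (∃ σ ∈ {σ : Lp E 1 μ | ∫ ω, σ ω ∂μ = 0},
      ⊥ < -eexp μ (fun ω => ⨆ y : E, ((inner ℝ (σ ω) y : ℝ) : EReal) - φ y ω)) ∧
    ⨆ σ ∈ {σ : Lp E 1 μ | ∫ ω, σ ω ∂μ = 0},
      -eexp μ (fun ω => ⨆ y : E, ((inner ℝ (σ ω) y : ℝ) : EReal) - φ y ω) =
      ⨅ χ, eexp μ (φ χ) := by
  choose χ hχ using fun k => h.exists_isMinimizer μ k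
  choose σ hσ0 hσ using fun k => h.exists_multiplier μ hφ k (hχ k)
  refine ⟨⟨σ 0, hσ0 0, (EReal.bot_lt_coe _).trans_le (hσ 0)⟩, le_antisymm ?_ ?_⟩
  · exact iSup₂_le fun τ hτ => le_iInf fun χ =>
      h.weak_duality μ hφ (L1.integrable_coeFn τ) hτ χ
  -- A real `t` above the dual value bounds every penalized minimum, hence the cost of some decision
  -- `χ'`.
  · refine EReal.le_of_forall_lt_iff_le.1 fun t ht => ?_
    obtain ⟨χ', hχ'⟩ := h.exists_eexp_le μ hφ (s := t) fun k => ⟨χ k, EReal.coe_le_coe_iff.1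
      ((hσ k).trans (le_trans (le_iSup₂ (f := fun (τ : Lp E 1 μ)
        (_ : τ ∈ {σ : Lp E 1 μ | ∫ ω, σ ω ∂μ = 0}) =>
        -eexp μ (fun ω => ⨆ y : E, ((inner ℝ (τ ω) y : ℝ) : EReal) - φ y ω)) (σ k) (hσ0 k))
        ht.le))⟩
    exact (iInf_le _ χ').trans hχ'

end Duality

end PenalizedProblem

/-! ### The market as a penalized two-stage problem. -/

namespace Market

section Reformulation

variable {Node Part Line Ω : Type*} [Fintype Part] [Fintype Line]

omit [Fintype Part] [Fintype Line] in
theorem isCompact_box (lo hi : Part ⊕ Line → ℝ) :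
    IsCompact {y : Dec Part Line | ∀ j, lo j ≤ y j ∧ y j ≤ hi j} := by
  have h := (isCompact_univ_pi fun j => isCompact_Icc (a := lo j) (b := hi j)).image
    (PiLp.continuous_toLp 2 fun _ : Part ⊕ Line => ℝ)
  convert h using 1
  ext y
  constructor
  · intro hy
    exact ⟨WithLp.ofLp y, fun j _ => hy j, rfl⟩
  · rintro ⟨z, hz, rfl⟩ j
    exact hz j trivial

variable (m : Market Node Part Line Ω)

/-- The real-time decisions that satisfy the capacity constraints which do not depend on the
scenario. -/
def realTimeSet : Set (Dec Part Line) :=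
  {y | (∀ i, m.Xmin i ≤ y (Sum.inl i) ∧ y (Sum.inl i) ≤ m.Xmax i) ∧
    (∀ l, m.Fmin l ≤ y (Sum.inr l) ∧ y (Sum.inr l) ≤ m.Fmax l) ∧
    (fun l => y (Sum.inr l)) ∈ m.flows}

/-- The pairs of decisions that satisfy all constraints which do not depend on the scenario. -/
def jointSet (ω : Ω) : Set (Dec Part Line × Dec Part Line) :=
  {w | w.1 ∈ m.C1 ∧ m.g1 w.1 = 0 ∧ w.2 ∈ m.realTimeSet ∧ m.g2 w.1 w.2 ω = 0}

/-- Total cost of a pair of decisions. -/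
noncomputable def totalCost (ω : Ω) (w : Dec Part Line × Dec Part Line) : ℝ :=
  m.f1 w.1 + m.f2 w.1 w.2 ω

/-- Violation of the availability constraints. -/
noncomputable def violation (w : Dec Part Line × Dec Part Line) (ω : Ω) : ℝ :=
  ∑ i, (max (-m.Xavail ω i - w.2 (Sum.inl i)) 0 + max (w.2 (Sum.inl i) - m.Xavail ω i) 0)

omit [Fintype Part] in
theorem continuous_netFlow : Continuous fun y : Dec Part Line => m.netFlow y := by
  unfold netFlow
  fun_prop

omit [Fintype Line] in
theorem continuous_injection : Continuous fun y : Dec Part Line => m.injection y := by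
  unfold injection
  fun_prop

theorem continuous_g1 : Continuous m.g1 := by
  exact m.continuous_netFlow.add m.continuous_injection

omit [Fintype Part] [Fintype Line] in
theorem mem_realTimeSet_of_mem_C2 {ω : Ω} {y : Dec Part Line} (hy : y ∈ m.C2 ω) :
    y ∈ m.realTimeSet :=
  ⟨fun i => ⟨(le_max_left _ _).trans (hy.1 i).1, (hy.1 i).2.trans (min_le_left _ _)⟩, hy.2⟩

theorem continuous_g2 (ω : Ω) :
    Continuous fun w : Dec Part Line × Dec Part Line => m.g2 w.1 w.2 ω := by
  have hn := m.continuous_netFlow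
  have hi := m.continuous_injection
  exact ((hn.comp continuous_snd).sub (hn.comp continuous_fst)).add
    ((hi.comp continuous_snd).sub (hi.comp continuous_fst))

omit [Fintype Part] in
theorem netFlow_combo (y z : Dec Part Line) (a b : ℝ) (n : Node) :
    m.netFlow (a • y + b • z) n = a * m.netFlow y n + b * m.netFlow z n := by
  simp only [netFlow, PiLp.add_apply, PiLp.smul_apply, smul_eq_mul, Finset.sum_add_distrib,
    ← Finset.mul_sum]
  ring

omit [Fintype Line] in
theorem injection_combo (y z : Dec Part Line) (a b : ℝ) (n : Node) :
    m.injection (a • y + b • z) n = a * m.injection y n + b * m.injection z n := by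
  simp only [injection, PiLp.add_apply, PiLp.smul_apply, smul_eq_mul, Finset.sum_add_distrib,
    ← Finset.mul_sum]

omit [Fintype Line] in
theorem continuous_totalCost (ω : Ω) : Continuous (m.totalCost ω) := by
  unfold totalCost f1 f2
  fun_prop

omit [Fintype Line] in
theorem continuous_violation (ω : Ω) : Continuous fun w => m.violation w ω := by
  unfold violation
  fun_prop

omit [Fintype Line] in
theorem violation_nonneg (w : Dec Part Line × Dec Part Line) (ω : Ω) : 0 ≤ m.violation w ω :=
  Finset.sum_nonneg fun _ _ => add_nonneg (le_max_right _ _) (le_max_right _ _)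

omit [Fintype Line] in
theorem violation_eq_zero_iff (w : Dec Part Line × Dec Part Line) (ω : Ω) :
    m.violation w ω = 0 ↔
      ∀ i, -m.Xavail ω i ≤ w.2 (Sum.inl i) ∧ w.2 (Sum.inl i) ≤ m.Xavail ω i := by
  rw [violation, Finset.sum_eq_zero_iff_of_nonneg
    fun _ _ => add_nonneg (le_max_right _ _) (le_max_right _ _)]
  refine ⟨fun h i => ?_, fun h i _ => ?_⟩
  · have h0 := h i (Finset.mem_univ i)
    have h1 := le_max_left (-m.Xavail ω i - w.2 (Sum.inl i)) 0
    have h2 := le_max_right (-m.Xavail ω i - w.2 (Sum.inl i)) 0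
    have h3 := le_max_left (w.2 (Sum.inl i) - m.Xavail ω i) 0
    have h4 := le_max_right (w.2 (Sum.inl i) - m.Xavail ω i) 0
    constructor <;> linarith
  · rw [max_eq_right (by linarith [(h i).1]), max_eq_right (by linarith [(h i).2]), add_zero]

omit [Fintype Line] in
theorem convexOn_violation (ω : Ω) : ConvexOn ℝ Set.univ fun w : Dec Part Line × Dec Part Line =>
    m.violation w ω := by
  refine ⟨convex_univ, fun w _ w' _ a b ha hb hab => ?_⟩
  simp only [violation, smul_eq_mul, Finset.mul_sum]
  rw [← Finset.sum_add_distrib]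
  refine Finset.sum_le_sum fun i _ => ?_
  simp only [Prod.snd_add, Prod.smul_snd, PiLp.add_apply, PiLp.smul_apply, smul_eq_mul]
  have key (s t : ℝ) : max (a * s + b * t) 0 ≤ a * max s 0 + b * max t 0 := by
    refine max_le (by gcongr <;> exact le_max_left _ _) ?_
    have := le_max_right s 0
    have := le_max_right t 0
    positivity
  have h1 := key (-m.Xavail ω i - w.2 (Sum.inl i)) (-m.Xavail ω i - w'.2 (Sum.inl i))
  have h2 := key (w.2 (Sum.inl i) - m.Xavail ω i) (w'.2 (Sum.inl i) - m.Xavail ω i)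
  have e1 : -m.Xavail ω i - (a * w.2 (Sum.inl i) + b * w'.2 (Sum.inl i))
      = a * (-m.Xavail ω i - w.2 (Sum.inl i)) + b * (-m.Xavail ω i - w'.2 (Sum.inl i)) := by
    linear_combination m.Xavail ω i * hab
  have e2 : a * w.2 (Sum.inl i) + b * w'.2 (Sum.inl i) - m.Xavail ω i
      = a * (w.2 (Sum.inl i) - m.Xavail ω i) + b * (w'.2 (Sum.inl i) - m.Xavail ω i) := by
    linear_combination m.Xavail ω i * hab
  rw [e1, e2]
  linarith

omit [Fintype Line] in
-- Nonemptiness of `C2 ω` forces `Xavail ω i ≥ 0`, so dropping it from each violation term only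
-- increases the term; the bound is uniform in the scenario.
theorem violation_le {ω : Ω} (hω : (m.C2 ω).Nonempty) {w : Dec Part Line × Dec Part Line}
    (hw : w.2 ∈ m.realTimeSet) :
    m.violation w ω ≤ ∑ i, (max (-m.Xmin i) 0 + max (m.Xmax i) 0) := by
  obtain ⟨y, hy⟩ := hω
  refine Finset.sum_le_sum fun i _ => ?_
  have h1 := (le_max_right _ _).trans (hy.1 i).1
  have h2 := (hy.1 i).2.trans (min_le_right _ _)
  have := hw.1 i
  gcongr <;> linarith

omit [Fintype Part] [Fintype Line] in
/-- The scenario-independent constraints inherit closedness from a capacity set `C₂(ω)`. -/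
theorem isClosed_realTimeSet {ω : Ω} (hne : (m.C2 ω).Nonempty) (hcl : IsClosed (m.C2 ω)) :
    IsClosed m.realTimeSet := by
  obtain ⟨y₀, hy₀⟩ := hne
  -- This map freezes the participant coordinates at those of `y₀`, so its image is in `C2 ω`
  -- exactly when the flow constraints hold; this isolates them without any topological assumption
  -- on `flows`.
  have hT : Continuous fun y : Dec Part Line => (WithLp.toLp 2
      (Sum.elim (fun i => y₀ (Sum.inl i)) fun l => y (Sum.inr l)) : Dec Part Line) := by
    refine (PiLp.continuous_toLp 2 _).comp (continuous_pi fun j => ?_)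
    cases j <;> simp only [Sum.elim_inl, Sum.elim_inr] <;> fun_prop
  have : m.realTimeSet =
      (⋂ i, {y : Dec Part Line | m.Xmin i ≤ y (Sum.inl i)} ∩ {y | y (Sum.inl i) ≤ m.Xmax i}) ∩
      (fun y : Dec Part Line => (WithLp.toLp 2
        (Sum.elim (fun i => y₀ (Sum.inl i)) fun l => y (Sum.inr l)) : Dec Part Line)) ⁻¹'
        m.C2 ω := by
    ext y
    simp only [Set.mem_inter_iff, Set.mem_iInter, Set.mem_preimage]
    exact ⟨fun hy => ⟨hy.1, hy₀.1, hy.2⟩, fun hy => ⟨hy.1, hy.2.2⟩⟩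
  rw [this]
  exact (isClosed_iInter fun i => (isClosed_le continuous_const (by fun_prop)).inter
    (isClosed_le (by fun_prop) continuous_const)).inter (hcl.preimage hT)

omit [Fintype Part] [Fintype Line] in
-- Freezing the participant coordinates at a point of `C2 ω` transfers convexity of `C2 ω` to the
-- flow constraints.
theorem convex_realTimeSet {ω : Ω} (hne : (m.C2 ω).Nonempty) (hconv : Convex ℝ (m.C2 ω)) :
    Convex ℝ m.realTimeSet := by
  obtain ⟨y₀, hy₀⟩ := hne
  intro y hy z hz a b ha hb hab
  let T : Dec Part Line → Dec Part Line := fun y =>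
    WithLp.toLp 2 (Sum.elim (fun i => y₀ (Sum.inl i)) fun l => y (Sum.inr l))
  have hTy : T y ∈ m.C2 ω := ⟨hy₀.1, hy.2⟩
  have hTz : T z ∈ m.C2 ω := ⟨hy₀.1, hz.2⟩
  refine ⟨fun i => ?_, (hconv hTy hTz ha hb hab).2⟩
  exact convex_Icc (m.Xmin i) (m.Xmax i) (hy.1 i) (hz.1 i) ha hb hab

omit [Fintype Part] [Fintype Line] in
theorem isCompact_realTimeSet {ω : Ω} (hne : (m.C2 ω).Nonempty) (hcl : IsClosed (m.C2 ω)) :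
    IsCompact m.realTimeSet := by
  refine (isCompact_box (Sum.elim m.Xmin m.Fmin) (Sum.elim m.Xmax m.Fmax)).of_isClosed_subset
    (m.isClosed_realTimeSet hne hcl) fun y hy j => ?_
  cases j with
  | inl i => exact hy.1 i
  | inr l => exact hy.2.1 l

omit [Fintype Part] [Fintype Line] in
theorem isCompact_C1 (hcl : IsClosed m.C1) : IsCompact m.C1 := by
  refine (isCompact_box (Sum.elim m.xmin m.fmin) (Sum.elim m.xmax m.fmax)).of_isClosed_subset
    hcl fun y hy j => ?_
  cases j with
  | inl i => exact hy.1 i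
  | inr l => exact hy.2.1 l

variable [MeasurableSpace Ω]

theorem isCompact_jointSet (hconv : m.ConvexityAssumption) (ω : Ω) :
    IsCompact (m.jointSet ω) := by
  have h := (m.isCompact_C1 hconv.closed_C1).prod
    (m.isCompact_realTimeSet (hconv.nonempty_C2 ω) (hconv.closed_C2 ω))
  convert (h.inter_right (isClosed_eq (m.continuous_g1.comp continuous_fst)
    (continuous_const (y := (0 : Node → ℝ))))).inter_right
    (isClosed_eq (m.continuous_g2 ω) (continuous_const (y := (0 : Node → ℝ)))) using 1
  ext w
  exact ⟨fun hw => ⟨⟨⟨hw.1, hw.2.2.1⟩, hw.2.1⟩, hw.2.2.2⟩,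
    fun hw => ⟨hw.1.1.1, hw.1.2, hw.1.1.2, hw.2⟩⟩

theorem convex_jointSet (hconv : m.ConvexityAssumption) (ω : Ω) : Convex ℝ (m.jointSet ω) := by
  rintro ⟨y, z⟩ ⟨hy, hgy, hz, hgz⟩ ⟨y', z'⟩ ⟨hy', hgy', hz', hgz'⟩ a b ha hb hab
  refine ⟨hconv.convex_C1 hy hy' ha hb hab, ?_,
    m.convex_realTimeSet (hconv.nonempty_C2 ω) (hconv.convex_C2 ω) hz hz' ha hb hab, ?_⟩
  · funext n
    have h1 := congrFun hgy n
    have h2 := congrFun hgy' n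
    simp only [g1, Pi.zero_apply, Prod.fst_add, Prod.smul_fst, netFlow_combo,
      injection_combo] at h1 h2 ⊢
    linear_combination a * h1 + b * h2
  · funext n
    have h1 := congrFun hgz n
    have h2 := congrFun hgz' n
    simp only [g2, Pi.zero_apply, Prod.fst_add, Prod.smul_fst, Prod.snd_add, Prod.smul_snd,
      netFlow_combo, injection_combo] at h1 h2 ⊢
    linear_combination a * h1 + b * h2

theorem penalizedProblem (hX : ∀ i, Measurable fun ω => m.Xavail ω i)
    (hconv : m.ConvexityAssumption) {ω₀ : Ω} (hne : (m.jointSet ω₀).Nonempty) :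
    PenalizedProblem (m.jointSet ω₀) (m.totalCost ω₀) m.violation
      (∑ i, (max (-m.Xmin i) 0 + max (m.Xmax i) 0)) where
  compact := m.isCompact_jointSet hconv ω₀
  convex := m.convex_jointSet hconv ω₀
  nonempty := hne
  cost_continuous := m.continuous_totalCost ω₀
  cost_convex := by
    have h1 : ConvexOn ℝ Set.univ fun w : Dec Part Line × Dec Part Line => m.f1 w.1 :=
      hconv.convex_f1.comp_linearMap (LinearMap.fst ℝ (Dec Part Line) (Dec Part Line))
    exact (h1.add (hconv.convex_f2 ω₀)).subset (Set.subset_univ _) (m.convex_jointSet hconv ω₀)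
  pen_continuous := m.continuous_violation
  pen_convex ω := (m.convexOn_violation ω).subset (Set.subset_univ _)
    (m.convex_jointSet hconv ω₀)
  pen_nonneg := m.violation_nonneg
  pen_le w hw ω := m.violation_le (hconv.nonempty_C2 ω) hw.2.2.1
  pen_measurable w := by
    unfold violation
    fun_prop

omit [MeasurableSpace Ω] in
-- The scenarios `ω₀` and `ω` may differ because `f2` and `g2` ignore their scenario argument.
theorem phi_le_totalCost {ω₀ : Ω} {w : Dec Part Line × Dec Part Line} (hw : w ∈ m.jointSet ω₀)
    {ω : Ω} (h0 : m.violation w ω = 0) : m.phi w.1 ω ≤ m.totalCost ω₀ w := by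
  rw [violation_eq_zero_iff] at h0
  rw [phi, if_pos ⟨hw.2.1, hw.1⟩, totalCost, EReal.coe_add]
  refine add_le_add le_rfl (iInf₂_le w.2 ⟨⟨fun i => ?_, hw.2.2.1.2⟩, hw.2.2.2⟩)
  exact ⟨max_le (hw.2.2.1.1 i).1 (h0 i).1, le_min (hw.2.2.1.1 i).2 (h0 i).2⟩

omit [MeasurableSpace Ω] in
theorem exists_totalCost_lt (ω₀ : Ω) {y : Dec Part Line} {ω : Ω} {t : EReal}
    (h : m.phi y ω < t) :
    ∃ w ∈ m.jointSet ω₀, w.1 = y ∧ m.violation w ω = 0 ∧ (m.totalCost ω₀ w : EReal) < t := by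
  unfold phi at h
  split_ifs at h with hy
  · by_contra! hcon
    refine absurd h (not_lt.2 ?_)
    -- The finite term `f1` is moved across so that the lower bound on `H` can be checked at each
    -- feasible `y₂`.
    rw [add_comm, ← EReal.sub_le_iff_le_add (Or.inl (EReal.coe_ne_bot _))
      (Or.inl (EReal.coe_ne_top _))]
    refine le_iInf₂ fun y₂ hy₂ => ?_
    rw [EReal.sub_le_iff_le_add (Or.inl (EReal.coe_ne_bot _)) (Or.inl (EReal.coe_ne_top _)),
      add_comm, ← EReal.coe_add]
    exact hcon (y, y₂) ⟨hy.2, hy.1, m.mem_realTimeSet_of_mem_C2 hy₂.1, hy₂.2⟩ rfl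
      ((m.violation_eq_zero_iff _ _).2 fun i =>
        ⟨(le_max_right _ _).trans (hy₂.1.1 i).1, (hy₂.1.1 i).2.trans (min_le_right _ _)⟩)
  · exact absurd h not_top_lt

/-- Feasible state vectors are almost surely constant, and every constant belongs to `L^∞`. -/
theorem primalValue_eq_iInf (μ : Measure Ω) [IsProbabilityMeasure μ] :
    m.primalValue μ = ⨅ χ, eexp μ (m.phi χ) := by
  refine le_antisymm (le_iInf fun χ => ?_) (le_iInf₂ fun p hp => ?_)
  · have hae : ∀ᵐ ω ∂μ, (Lp.const ∞ μ χ) ω = χ := Lp.coeFn_const ∞ μ χ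
    refine (iInf₂_le (Lp.const ∞ μ χ, χ) (hae.mono fun ω hω => sub_eq_zero.2 hω)).trans ?_
    exact eexp_mono (hae.mono fun ω hω => (congrArg (m.phi · ω) hω).le)
  · have hp' : ∀ᵐ ω ∂μ, p.1 ω - p.2 = 0 := hp
    exact (iInf_le _ p.2).trans
      (eexp_mono (hp'.mono fun ω hω => (congrArg (m.phi · ω) (sub_eq_zero.1 hω)).ge))

/-- A finite optimal value requires that the scenario-independent constraints are feasible. -/
theorem jointSet_nonempty (μ : Measure Ω) [IsProbabilityMeasure μ] (hfin : m.primalValue μ < ⊤)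
    (ω₀ : Ω) : (m.jointSet ω₀).Nonempty := by
  rw [primalValue_eq_iInf, iInf_lt_iff] at hfin
  obtain ⟨χ, hχ⟩ := hfin
  by_contra hempty
  have htop (ω : Ω) : m.phi χ ω = ⊤ := by
    by_contra hne
    obtain ⟨w, hw, -⟩ := m.exists_totalCost_lt ω₀ (lt_top_iff_ne_top.2 hne)
    exact hempty ⟨w, hw⟩
  refine hχ.ne ?_
  unfold eexp
  simp [htop]

end Reformulation

end Market

theorem proposition3 {Node Part Line Ω : Type*} [Fintype Part] [Fintype Line]
    [MeasurableSpace Ω] (μ : Measure Ω) [IsProbabilityMeasure μ]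
    (m : Market Node Part Line Ω)
    (hXavail : ∀ i, Measurable fun ω => m.Xavail ω i)
    (hconv : m.ConvexityAssumption)
    (ybar : Lp (Dec Part Line) ∞ μ) (χbar : Dec Part Line)
    (hopt : m.IsPrimalOptimal μ ybar χbar)
    (hfin : m.primalValue μ < ⊤) :
    (∃ σ ∈ Market.multipliers Part Line μ, ⊥ < m.dualObj μ σ) ∧
      m.dualValue μ = m.primalValue μ := by
  -- Any scenario serves: `jointSet` and `totalCost` depend on it only formally.
  obtain ⟨ω₀⟩ := nonempty_of_isProbabilityMeasure μ
  have h := m.penalizedProblem hXavail hconv (m.jointSet_nonempty μ hfin ω₀)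
  rw [m.primalValue_eq_iInf μ]
  exact h.strong_duality μ (h.iSup_penalizedValue
    (fun _ hw _ h0 => m.phi_le_totalCost hw h0) fun _ _ _ ht => m.exists_totalCost_lt ω₀ ht)
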